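/- Let $E$ be a real Banach space, let $4\le k\le\infty$, and let $B$ be a Hausdorff $C^k$ Banach manifold modelled on $E$, with tangent bundle $\tau:TB\to B$, a $C^{k-1}$ manifold. Let $s$ be a spray on $B$ of class $C^r$, where $2\le r\le k-2$: a $C^r$ vector field $s:TB\to T(TB)$ on $TB$ with $\tau_*\circ s=\mathrm{id}_{TB}$ and $s(cv)=(L_c)_*(c\,s(v))$ for all $c\in\mathbb R$, $v\in TB$, where $L_c:TB\to TB$ is the fibrewise multiplication $v\mapsto cv$. A geodesic of $s$ is a curve $g:J\to B$ on a nondegenerate interval $J\subseteq\mathbb R$ (derivatives at endpoints in $J$ are one-sided) whose canonical lift $g':J\to TB$ is an integral curve of $s$. For a subset $A$ of a Banach manifold $M$ and $x\in A$, a vector $w\in T_xM$ belongs to the adjacent cone $T_xA$ if there is a chart $(U,\varphi)$ around $x$ with $$\lim_{t\to0^+}t^{-1}\,d\big(\varphi(x)+t\,d\varphi_x(w),\ \varphi(U\cap A)\big)=0 ,$$ where $d$ is the norm distance from a point to a set in the model space. A vector field $X$ on $M$ is adjacent tangent to $A$ if $X(x)\in T_xA$ for every $x\in A$. For $S\subseteq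 B$, $x\in S$ and $v\in T_xS$, a vector $w\in T_v(TB)$ is a second-order adjacent tangent vector to $S$ at $x$ (associated with $v$) if there is a chart $(U,\varphi)$ of $B$ around $x$ such that, writing $v_\varphi=d\varphi_x(v)$ and $(w_1,w_2)=d(T\varphi)_v(w)\in E\times E$, one has $w_1=v_\varphi$ and $$\lim_{t\to0^+}t^{-2}\,d\big(\varphi(x)+t\,v_\varphi+\tfrac12t^2\,w_2,\ \varphi(U\cap S)\big)=0 .$$ The admissible set $A_{s,S}\subseteq TB$ is the set of all $v\in TB$ with $\tau(v)\in S$ such that $s(v)$ is a second-order adjacent tangent vector to $S$ at $\tau(v)$ (associated with $v$). The set $S$ is spray-invariant if, for every geodesic $g:J\to B$ of $s$ with $0\in J$, $g(0)\in S$ and $g'(0)\in A_{s,S}$, one has $g(t)\in S$ for all $t\in J$. Theorem. Let $S\subseteq B$ be a subset such that $A_{s,S}$ is non-empty and closed in $TB$. Then $S$ is spray-invariant if and only if $s$, regarded as a vector field on $TB$, is adjacent tangent to $A_{s,S}$. -/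

import Mathlib

open Set Filter Topology Manifold

noncomputable section

/-- The adjacent tangent vectors to a subset `A` of a manifold `M` (modelled on a normed space
`F`): the set of all tangent vectors `w` with foot point `x = w.proj` in `A` such that, in some
`C^n` chart `φ` of `M` around `x`,
`t⁻¹ d(φ(x) + t dφₓ(w), φ(U ∩ A)) → 0` as `t → 0⁺`, where `U` is the domain of `φ`.
The vectors with foot point `x` form the adjacent cone `T_x A`. -/
def adjacentVectors {F : Type*} [NormedAddCommGroup F] [NormedSpace ℝ F]
    {H : Type*} [TopologicalSpace H] (I : ModelWithCorners ℝ F H)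
    {M : Type*} [TopologicalSpace M] [ChartedSpace H M] (n : ℕ∞) (A : Set M) :
    Set (TangentBundle I M) :=
  {w | w.proj ∈ A ∧ ∃ φ ∈ IsManifold.maximalAtlas I n M, w.proj ∈ φ.source ∧
    let wφ : F := mfderiv I 𝓘(ℝ, F) (φ.extend I) w.proj w.2
    Tendsto (fun t : ℝ => t⁻¹ * Metric.infDist (φ.extend I w.proj + t • wφ)
        (φ.extend I '' (φ.source ∩ A)))
      (𝓝[>] 0) (𝓝 0)}

/-- The tangent map `φ_* = Tφ : TU → E × E`, `(p, u) ↦ (φ(p), dφ_p(u))`, of a chart `φ : U → E`. -/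
def tangentChart {E : Type*} [NormedAddCommGroup E] [NormedSpace ℝ E]
    {B : Type*} [TopologicalSpace B] [ChartedSpace E B] (φ : OpenPartialHomeomorph B E) :
    TangentBundle 𝓘(ℝ, E) B → E × E :=
  fun u => (φ u.proj, mfderiv 𝓘(ℝ, E) 𝓘(ℝ, E) φ u.proj u.2)

/-- `IsSecondOrderAdjacent k S v w`: the vector `w ∈ T_v(TB)` is a second-order adjacent tangent
vector to `S ⊆ B` at the foot point `x` of `v` (associated with `v`). This means `x ∈ S`,
`v ∈ T_x S`, and for some `C^k` chart `φ : U → E` around `x`, writing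
`d(φ_*)_v(w) = (w₁, w₂)` and `v_φ = dφ_x(v)`, one has `w₁ = v_φ` and
`t⁻² d(φ(x) + t v_φ + (t²/2) w₂, φ(U ∩ S)) → 0` as `t → 0⁺`. -/
def IsSecondOrderAdjacent {E : Type*} [NormedAddCommGroup E] [NormedSpace ℝ E]
    {B : Type*} [TopologicalSpace B] [ChartedSpace E B] [IsManifold 𝓘(ℝ, E) 2 B]
    (k : ℕ∞) (S : Set B) (v : TangentBundle 𝓘(ℝ, E) B)
    (w : TangentSpace 𝓘(ℝ, E).tangent v) : Prop :=
  v.proj ∈ S ∧ v ∈ adjacentVectors 𝓘(ℝ, E) k S ∧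
    ∃ φ ∈ IsManifold.maximalAtlas 𝓘(ℝ, E) k B, v.proj ∈ φ.source ∧
      let vφ : E := mfderiv 𝓘(ℝ, E) 𝓘(ℝ, E) φ v.proj v.2
      let wφ : E × E := mfderiv 𝓘(ℝ, E).tangent 𝓘(ℝ, E × E) (tangentChart φ) v w
      wφ.1 = vφ ∧
      Tendsto (fun t : ℝ => (t ^ 2)⁻¹ * Metric.infDist
          (φ v.proj + t • vφ + ((1 / 2 : ℝ) * t ^ 2) • wφ.2) (φ '' (φ.source ∩ S)))
        (𝓝[>] 0) (𝓝 0)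

/-- Multiplication by `c` in the fibres of the tangent bundle. -/
def fiberSmul {E : Type*} [NormedAddCommGroup E] [NormedSpace ℝ E]
    {B : Type*} [TopologicalSpace B] [ChartedSpace E B] (c : ℝ) :
    TangentBundle 𝓘(ℝ, E) B → TangentBundle 𝓘(ℝ, E) B :=
  fun v => ⟨v.proj, c • v.2⟩

/-- A vector field `s` on `TB` is a spray of class `C^r` on `B` if it is of class `C^r` as a map
`TB → T(TB)`, is of second order (`τ_* ∘ s = id`, where `τ : TB → B`), and satisfies
`s(c v) = (L_c)_* (c s(v))` for all real `c`, where `L_c : TB → TB` is `v ↦ c v`.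
(The symmetry condition `τ₂ ∘ s = id`, where `τ₂ : T(TB) → TB`, is built into the type of `s`.) -/
structure IsSpray {E : Type*} [NormedAddCommGroup E] [NormedSpace ℝ E]
    {B : Type*} [TopologicalSpace B] [ChartedSpace E B] [IsManifold 𝓘(ℝ, E) 2 B]
    (r : ℕ∞) (s : (v : TangentBundle 𝓘(ℝ, E) B) → TangentSpace 𝓘(ℝ, E).tangent v) : Prop where
  contMDiff : ContMDiff 𝓘(ℝ, E).tangent 𝓘(ℝ, E).tangent.tangent r
    (fun v => (⟨v, s v⟩ : TangentBundle 𝓘(ℝ, E).tangent (TangentBundle 𝓘(ℝ, E) B)))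
  second_order : ∀ v : TangentBundle 𝓘(ℝ, E) B,
    mfderiv 𝓘(ℝ, E).tangent 𝓘(ℝ, E)
      (fun u : TangentBundle 𝓘(ℝ, E) B => u.proj) v (s v) = v.2
  homogeneous : ∀ (c : ℝ) (v : TangentBundle 𝓘(ℝ, E) B),
    s (fiberSmul c v) =
      mfderiv 𝓘(ℝ, E).tangent 𝓘(ℝ, E).tangent (fiberSmul (E := E) (B := B) c) v (c • s v)

/-- The canonical lift `t ↦ (g(t), g'(t))` to `TB` of a curve `g` defined on the interval `J`. -/
def canonicalLift {E : Type*} [NormedAddCommGroup E] [NormedSpace ℝ E]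
    {B : Type*} [TopologicalSpace B] [ChartedSpace E B] (g : ℝ → B) (J : Set ℝ) :
    ℝ → TangentBundle 𝓘(ℝ, E) B :=
  fun t => ⟨g t, mfderivWithin 𝓘(ℝ, ℝ) 𝓘(ℝ, E) g J t (1 : ℝ)⟩

/-- A curve `g : J → B` is a geodesic of `s` if its canonical lift is an integral curve of `s`. -/
def IsGeodesicOn {E : Type*} [NormedAddCommGroup E] [NormedSpace ℝ E]
    {B : Type*} [TopologicalSpace B] [ChartedSpace E B] [IsManifold 𝓘(ℝ, E) 2 B]
    (s : (v : TangentBundle 𝓘(ℝ, E) B) → TangentSpace 𝓘(ℝ, E).tangent v)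
    (g : ℝ → B) (J : Set ℝ) : Prop :=
  IsMIntegralCurveOn (canonicalLift (E := E) g J) s J

/-- The admissible set `A_{s,S}`: all tangent vectors `v` with foot point `τ(v) ∈ S` such that
`s(v)` is a second-order adjacent tangent vector to `S` at `τ(v)`. -/
def admissibleSet {E : Type*} [NormedAddCommGroup E] [NormedSpace ℝ E]
    {B : Type*} [TopologicalSpace B] [ChartedSpace E B] [IsManifold 𝓘(ℝ, E) 2 B] (k : ℕ∞)
    (s : (v : TangentBundle 𝓘(ℝ, E) B) → TangentSpace 𝓘(ℝ, E).tangent v) (S : Set B) :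
    Set (TangentBundle 𝓘(ℝ, E) B) :=
  {v | v.proj ∈ S ∧ IsSecondOrderAdjacent k S v (s v)}

/-- `S` is spray-invariant: every geodesic `g : J → B` of `s`, on any nondegenerate interval `J`
containing `0`, with `g(0) ∈ S` and `g'(0) ∈ A_{s,S}`, satisfies `g(t) ∈ S` for all `t ∈ J`. -/
def IsSprayInvariant {E : Type*} [NormedAddCommGroup E] [NormedSpace ℝ E]
    {B : Type*} [TopologicalSpace B] [ChartedSpace E B] [IsManifold 𝓘(ℝ, E) 2 B] (k : ℕ∞)
    (s : (v : TangentBundle 𝓘(ℝ, E) B) → TangentSpace 𝓘(ℝ, E).tangent v) (S : Set B) : Prop :=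
  ∀ (J : Set ℝ) (g : ℝ → B), J.OrdConnected → J.Nontrivial → (0 : ℝ) ∈ J →
    IsGeodesicOn s g J → g 0 ∈ S → canonicalLift g J 0 ∈ admissibleSet k s S →
    ∀ t ∈ J, g t ∈ S

/-- The vector field `X` on the manifold `M` is adjacent tangent to `A ⊆ M`, with respect to
`C^n` charts: `X(x) ∈ T_x A` for every `x ∈ A`. -/
def IsAdjacentTangent {F : Type*} [NormedAddCommGroup F] [NormedSpace ℝ F]
    {H : Type*} [TopologicalSpace H] (I : ModelWithCorners ℝ F H)
    {M : Type*} [TopologicalSpace M] [ChartedSpace H M] (n : ℕ∞)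
    (X : (x : M) → TangentSpace I x) (A : Set M) : Prop :=
  ∀ x ∈ A, (⟨x, X x⟩ : TangentBundle I M) ∈ adjacentVectors I n A

/-- A manifold of class `C^k` with `k ≥ 4` is of class `C^2`, hence has a tangent bundle and a
double tangent bundle. -/
theorem isManifold_two {E : Type*} [NormedAddCommGroup E] [NormedSpace ℝ E]
    {B : Type*} [TopologicalSpace B] [ChartedSpace E B] {k : ℕ∞} (hk : 4 ≤ k)
    [IsManifold 𝓘(ℝ, E) k B] : IsManifold 𝓘(ℝ, E) 2 B := by
  have h : (2 : ℕ∞) ≤ k := le_trans (by norm_num) hk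
  have h' : ((2 : ℕ∞) : WithTop ℕ∞) ≤ (k : WithTop ℕ∞) := WithTop.coe_le_coe.2 h
  exact IsManifold.of_le (n := (k : WithTop ℕ∞)) h'

end

/-! An integral curve γ of a spray projects to a curve with velocity γ, so geodesics are the
projections of integral curves of `s` on TB. In a chart, the projected curve has a second-order
Taylor expansion whose coefficients are γ(0) and the second component of s(γ(0)). Hence γ(0) is
admissible as soon as its geodesic stays in S for short positive time
(`IsSpray.mem_admissibleSet_of_isMIntegralCurveOn`).

If S is spray-invariant, apply this at each later time of a geodesic with admissible start: γ stays
in the admissible set A, so its initial velocity s(γ(0)) is adjacent tangent to A. Conversely, if s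
is adjacent tangent to the closed set A, Nagumo's theorem keeps γ in A for positive times, so the
geodesic stays in S. Negative times reduce to positive ones by the reversal v ↦ -v, under which A is
symmetric (`IsSpray.fiberSmul_neg_one_mem`).

Nagumo's theorem is proved in a Banach space by Zorn's lemma, without compactness. It transfers to
manifolds because adjacency in one chart amounts to being the right derivative at 0 of a curve in A,
a condition free of charts. -/

noncomputable section

/-! ### Nagumo's theorem in a Banach space -/

/-- **Nagumo's theorem** in a Banach space, for a fixed time: a solution `u` of `u' = f (u)` that
starts in a closed set `C`, to which `f` is tangent, is in `C` at time `δ`. All hypotheses on `f`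
are local, on the part of `C` in the ball of radius `R` around `u 0`. -/
theorem mem_of_subtangent {F : Type*} [NormedAddCommGroup F] [NormedSpace ℝ F] [CompleteSpace F]
    {C : Set F} {f : F → F} {u : ℝ → F} {R K M δ : ℝ} (hC : IsClosed C) (hδ : 0 ≤ δ)
    (hK0 : 0 ≤ K) (hM0 : 0 ≤ M) (hu : ContinuousOn u (Icc 0 δ))
    (hu' : ∀ t ∈ Ico 0 δ, HasDerivWithinAt u (f (u t)) (Ici t) t) (hu0 : u 0 ∈ C)
    (hK : ∀ t ∈ Icc 0 δ, ∀ y ∈ C, ‖y - u 0‖ < R → ‖f (u t) - f y‖ ≤ K * ‖u t - y‖)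
    (hM : ∀ y ∈ C, ‖y - u 0‖ < R → ‖f y‖ ≤ M) (hMR : (M + 1) * δ < R)
    (htan : ∀ y ∈ C, ‖y - u 0‖ < R → ∀ ε > 0, ∀ᶠ h : ℝ in 𝓝[>] 0,
      ∃ y' ∈ C, ‖y' - y - h • f y‖ ≤ ε * h) : u δ ∈ C := by
  have key : ∀ ε : ℝ, 0 < ε → ε ≤ 1 → ∃ y ∈ C, Real.exp (-K * δ) * ‖u δ - y‖ ≤ 2 * ε * δ := by
    intro ε hε hε1
    -- `P` records the end points of approximate solutions in `C`. The first estimate keeps them in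
    -- the ball of radius `R`; the second is a Gronwall bound, with one `ε` for the error of `u` and
    -- one for the error of tangency.
    let P : Set (ℝ × F) := {p | p.1 ∈ Icc 0 δ ∧ p.2 ∈ C ∧ ‖p.2 - u 0‖ ≤ (M + 1) * p.1 ∧
      Real.exp (-K * p.1) * ‖u p.1 - p.2‖ ≤ 2 * ε * p.1}
    -- The speed bound in the order makes chains Lipschitz in time, so that they converge as time
    -- tends to its supremum. A maximal element must then have time `δ`.
    let r : P → P → Prop := fun p q => p.1.1 ≤ q.1.1 ∧
      ‖q.1.2 - p.1.2‖ ≤ (M + 1) * (q.1.1 - p.1.1)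
    have hP0 : ((0, u 0) : ℝ × F) ∈ P := by
      refine ⟨⟨le_rfl, hδ⟩, hu0, by simp, by simp⟩
    have htrans : ∀ {a b c}, r a b → r b c → r a c := by
      rintro a b c ⟨h1, h2⟩ ⟨h3, h4⟩
      refine ⟨h1.trans h3, ?_⟩
      have := norm_sub_le_norm_sub_add_norm_sub c.1.2 b.1.2 a.1.2
      nlinarith
    obtain ⟨m, hm⟩ := exists_maximal_of_chains_bounded (r := r) (by
      intro c hc
      rcases c.eq_empty_or_nonempty with rfl | hne
      · exact ⟨⟨_, hP0⟩, by simp⟩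
      have hbd : BddAbove ((fun p : P => p.1.1) '' c) := ⟨δ, by
        rintro _ ⟨p, -, rfl⟩
        exact p.2.1.2⟩
      obtain ⟨t, -, ht, htc⟩ := exists_seq_tendsto_sSup (hne.image (fun p : P => p.1.1)) hbd
      choose p hpc hpt using htc
      set T := sSup ((fun p : P => p.1.1) '' c)
      have hcl : ∀ a ∈ c, ∀ b ∈ c, ‖a.1.2 - b.1.2‖ ≤ (M + 1) * |a.1.1 - b.1.1| := by
        intro a ha b hb
        rcases eq_or_ne a b with rfl | hab
        · simp
        rcases hc ha hb hab with ⟨h1, h2⟩ | ⟨h1, h2⟩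
        · rw [norm_sub_rev, abs_sub_comm, abs_of_nonneg (sub_nonneg.2 h1)]; exact h2
        · rw [abs_of_nonneg (sub_nonneg.2 h1)]; exact h2
      have hcau : CauchySeq (fun n => (p n).1.2) := by
        have ht' := ht.cauchySeq
        rw [Metric.cauchySeq_iff] at ht' ⊢
        intro η hη
        obtain ⟨N, hN⟩ := ht' (η / (M + 1)) (by positivity)
        refine ⟨N, fun i hi j hj => ?_⟩
        have h1 := hN i hi j hj
        have h2 := hcl _ (hpc i) _ (hpc j)
        rw [lt_div_iff₀ (by positivity), Real.dist_eq, ← hpt, ← hpt] at h1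
        rw [dist_eq_norm]
        simp only at h1
        linarith
      obtain ⟨x, hx⟩ := cauchySeq_tendsto_of_complete hcau
      have hpT : Tendsto (fun n => (p n).1.1) atTop (𝓝 T) := ht.congr fun n => (hpt n).symm
      have hTI : T ∈ Icc 0 δ := isClosed_Icc.mem_of_tendsto hpT (.of_forall fun n => (p n).2.1)
      have huT : Tendsto (fun n => u (p n).1.1) atTop (𝓝 (u T)) :=
        (hu T hTI).tendsto.comp (tendsto_nhdsWithin_iff.2 ⟨hpT, .of_forall fun n => (p n).2.1⟩)
      have hTP : ((T, x) : ℝ × F) ∈ P := by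
        refine ⟨hTI, hC.mem_of_tendsto hx (.of_forall fun n => (p n).2.2.1), ?_, ?_⟩
        · exact le_of_tendsto_of_tendsto' (hx.sub_const _).norm (hpT.const_mul _)
            fun n => (p n).2.2.2.1
        · exact le_of_tendsto_of_tendsto'
            (((Real.continuous_exp.tendsto _).comp (hpT.const_mul _)).mul (huT.sub hx).norm)
            (hpT.const_mul _) fun n => (p n).2.2.2.2
      refine ⟨⟨_, hTP⟩, fun a ha => ?_⟩
      have haT : a.1.1 ≤ T := le_csSup hbd ⟨a, ha, rfl⟩
      refine ⟨haT, ?_⟩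
      have := le_of_tendsto_of_tendsto' (hx.sub_const a.1.2).norm
        ((hpT.sub_const a.1.1).abs.const_mul (M + 1)) fun n => hcl _ (hpc n) a ha
      rwa [abs_of_nonneg (sub_nonneg.2 haT)] at this) htrans
    obtain ⟨⟨⟨t, y⟩, ⟨ht0, htδ⟩, hyC, hyR, hyV⟩, hmax⟩ : ∃ m, ∀ a, r m a → r a m := ⟨m, hm⟩
    simp only at ht0 htδ hyC hyR hyV
    rcases htδ.eq_or_lt with rfl | htlt
    · exact ⟨y, hyC, hyV⟩
    exfalso
    have hyball : ‖y - u 0‖ < R := by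
      refine hyR.trans_lt (lt_of_le_of_lt ?_ hMR)
      gcongr
    have h1 : ∀ᶠ h : ℝ in 𝓝[>] 0, ‖u (t + h) - u t - h • f (u t)‖ ≤ ε * h := by
      have h2 := (hasDerivWithinAt_iff_isLittleO.1 (hu' t ⟨ht0, htlt⟩)).def hε
      have h3 : Tendsto (fun h : ℝ => t + h) (𝓝[>] 0) (𝓝[≥] t) := by
        refine tendsto_nhdsWithin_iff.2 ⟨?_, ?_⟩
        · have : Tendsto (fun h : ℝ => t + h) (𝓝 0) (𝓝 (t + 0)) := by
            exact (continuous_const.add continuous_id).tendsto 0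
          rw [add_zero] at this
          exact this.mono_left nhdsWithin_le_nhds
        · filter_upwards [self_mem_nhdsWithin] with h hh
          exact le_add_of_nonneg_right (mem_Ioi.1 hh).le
      filter_upwards [h3.eventually h2, self_mem_nhdsWithin] with h hh hpos
      have hpos : 0 < h := hpos
      simpa [abs_of_pos hpos] using hh
    have h4 : ∀ᶠ h : ℝ in 𝓝[>] 0, h < δ - t :=
      nhdsWithin_le_nhds (Iio_mem_nhds (sub_pos.2 htlt))
    obtain ⟨h, ⟨⟨hh1, y', hy'C, hy'⟩, hhδ⟩, hhpos⟩ :=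
      (((h1.and (htan y hyC hyball ε hε)).and h4).and self_mem_nhdsWithin).exists
    have hhpos : 0 < h := hhpos
    -- The speed is at most `M` from `f` plus `ε ≤ 1` from the tangency error.
    have hyy' : ‖y' - y‖ ≤ (M + 1) * h := by
      have e : y' - y = (y' - y - h • f y) + h • f y := by abel
      have := norm_add_le (y' - y - h • f y) (h • f y)
      rw [← e, norm_smul, Real.norm_of_nonneg hhpos.le] at this
      nlinarith [hM y hyC hyball]
    have hq : ((t + h, y') : ℝ × F) ∈ P := by
      refine ⟨⟨by positivity, by simp only; linarith⟩, hy'C, ?_, ?_⟩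
      · have := norm_sub_le_norm_sub_add_norm_sub y' y (u 0)
        simp only
        linarith
      · simp only
        have hD : ‖u (t + h) - y'‖ ≤ (1 + K * h) * ‖u t - y‖ + 2 * ε * h := by
          have e : u (t + h) - y' = (u (t + h) - u t - h • f (u t)) + (u t - y)
              + h • (f (u t) - f y) - (y' - y - h • f y) := by
            rw [smul_sub]; abel
          rw [e]
          have n1 := norm_sub_le ((u (t + h) - u t - h • f (u t)) + (u t - y)
              + h • (f (u t) - f y)) (y' - y - h • f y)
          have n2 := norm_add₃_le (a := u (t + h) - u t - h • f (u t)) (b := u t - y)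
              (c := h • (f (u t) - f y))
          rw [norm_smul, Real.norm_of_nonneg hhpos.le] at n2
          have n3 := hK t ⟨ht0, htδ⟩ y hyC hyball
          nlinarith [mul_le_mul_of_nonneg_left n3 hhpos.le]
        -- The weight `exp (-K t)` absorbs the growth factor of one step.
        have hexp : 1 + K * h ≤ Real.exp (K * h) := by
          linarith [Real.add_one_le_exp (K * h)]
        have e1 : Real.exp (-K * (t + h)) ≤ 1 := by
          rw [Real.exp_le_one_iff]
          nlinarith [mul_nonneg hK0 (add_nonneg ht0 hhpos.le)]
        have e2 : Real.exp (-K * (t + h)) * Real.exp (K * h) = Real.exp (-K * t) := by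
          rw [← Real.exp_add]; ring_nf
        have e3 := Real.exp_pos (-K * (t + h))
        calc Real.exp (-K * (t + h)) * ‖u (t + h) - y'‖
            ≤ Real.exp (-K * (t + h)) * (Real.exp (K * h) * ‖u t - y‖ + 2 * ε * h) := by
              gcongr
              refine hD.trans ?_
              gcongr
          _ = Real.exp (-K * t) * ‖u t - y‖ + Real.exp (-K * (t + h)) * (2 * ε * h) := by
              rw [mul_add, ← mul_assoc, e2]
          _ ≤ 2 * ε * t + 1 * (2 * ε * h) := by gcongr
          _ = 2 * ε * (t + h) := by ring
    have := (hmax ⟨_, hq⟩ ⟨by simp only; linarith, by simpa using hyy'⟩).1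
    simp only at this
    linarith
  rw [← hC.closure_eq, Metric.mem_closure_iff]
  intro η hη
  have hE := Real.exp_pos (-K * δ)
  -- This makes `2 * ε * δ` smaller than `η * exp (-K δ)`; `δ + 1` covers the case `δ = 0`.
  let ε := min 1 (η * Real.exp (-K * δ) / (4 * (δ + 1)))
  have hε : 0 < ε := by positivity
  obtain ⟨y, hy, hyd⟩ := key ε hε (min_le_left _ _)
  refine ⟨y, hy, ?_⟩
  rw [dist_eq_norm]
  have h1 : ε ≤ η * Real.exp (-K * δ) / (4 * (δ + 1)) := min_le_right _ _
  rw [le_div_iff₀ (by positivity)] at h1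
  have h2 : Real.exp (-K * δ) * ‖u δ - y‖ < Real.exp (-K * δ) * η := by nlinarith
  exact lt_of_mul_lt_mul_left h2 hE.le

/-! ### Adjacent vectors as velocities of curves, and Nagumo's theorem on manifolds -/

section Tangency

variable {F : Type*} [NormedAddCommGroup F] [NormedSpace ℝ F]
  {H : Type*} [TopologicalSpace H] {I : ModelWithCorners ℝ F H}
  {M : Type*} [TopologicalSpace M] [ChartedSpace H M]

/-- The composition of a curve on a manifold with a differentiable map to a normed space. -/
theorem hasDerivWithinAt_comp_of_hasMFDerivWithinAt {G : Type*} [NormedAddCommGroup G]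
    [NormedSpace ℝ G] {γ : ℝ → M} {J : Set ℝ} {t : ℝ} {w : TangentSpace I (γ t)}
    {ψ : M → G} {L : G} (hψ : MDifferentiableAt I 𝓘(ℝ, G) ψ (γ t))
    (hL : mfderiv I 𝓘(ℝ, G) ψ (γ t) w = L)
    (hγ : HasMFDerivWithinAt 𝓘(ℝ, ℝ) I γ J t ((1 : ℝ →L[ℝ] ℝ).smulRight w)) :
    HasDerivWithinAt (ψ ∘ γ) L J t := by
  have h := (hψ.hasMFDerivAt.comp_hasMFDerivWithinAt t hγ).hasFDerivWithinAt
  have h2 : HasDerivWithinAt (ψ ∘ γ) _ J t := HasFDerivWithinAt.hasDerivWithinAt h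
  refine h2.congr_deriv ?_
  rw [← hL]
  change mfderiv I 𝓘(ℝ, G) ψ (γ t) ((1 : ℝ) • w) = _
  rw [one_smul]

/-- The image of a curve in a normed space under a differentiable map to a manifold. -/
theorem hasMFDerivWithinAt_comp_of_hasDerivWithinAt {G : Type*} [NormedAddCommGroup G]
    [NormedSpace ℝ G] {b : ℝ → G} {J : Set ℝ} {t : ℝ} {w : G}
    {χ : G → M} (hχ : MDifferentiableAt 𝓘(ℝ, G) I χ (b t)) (hb : HasDerivWithinAt b w J t) :
    HasMFDerivWithinAt 𝓘(ℝ, ℝ) I (χ ∘ b) J t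
      ((1 : ℝ →L[ℝ] ℝ).smulRight (mfderiv 𝓘(ℝ, G) I χ (b t) w)) := by
  have h := hb.hasFDerivWithinAt.hasMFDerivWithinAt
  refine (hχ.hasMFDerivAt.comp_hasMFDerivWithinAt t h).congr_mfderiv ?_
  refine ContinuousLinearMap.ext fun (c : ℝ) => ?_
  exact map_smul (mfderiv 𝓘(ℝ, G) I χ (b t)) c w

/-- A curve that stays in `A` for small positive times has an initial velocity
adjacent tangent to `A`. -/
theorem mem_adjacentVectors_of_curve {n : ℕ∞} (hn : 1 ≤ n) [IsManifold I n M] {A : Set M}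
    {a : ℝ → M} {w : TangentSpace I (a 0)} (h0 : a 0 ∈ A) (ha : ∀ᶠ t in 𝓝[>] (0 : ℝ), a t ∈ A)
    (hw : HasMFDerivWithinAt 𝓘(ℝ, ℝ) I a (Ici 0) 0 ((1 : ℝ →L[ℝ] ℝ).smulRight w)) :
    (⟨a 0, w⟩ : TangentBundle I M) ∈ adjacentVectors I n A := by
  have hn' : (1 : WithTop ℕ∞) ≤ n := by exact_mod_cast hn
  have : IsManifold I 1 M := IsManifold.of_le (n := n) hn'
  refine ⟨h0, chartAt H (a 0), IsManifold.chart_mem_maximalAtlas _, mem_chart_source _ _, ?_⟩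
  intro L
  have hd : HasDerivWithinAt (extChartAt I (a 0) ∘ a) L (Ici 0) 0 :=
    hasDerivWithinAt_comp_of_hasMFDerivWithinAt
      (mdifferentiableAt_extChartAt (I := I) (mem_chart_source H (a 0))) rfl hw
  change Tendsto (fun t : ℝ => t⁻¹ * Metric.infDist (extChartAt I (a 0) (a 0) + t • L)
    (extChartAt I (a 0) '' ((chartAt H (a 0)).source ∩ A))) _ _
  rw [Metric.tendsto_nhds]
  intro ε hε
  have h1 := (hasDerivWithinAt_iff_isLittleO.1 hd).def (half_pos hε)
  have h2 : ∀ᶠ t in 𝓝[≥] (0 : ℝ), a t ∈ (chartAt H (a 0)).source :=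
    hw.1.preimage_mem_nhdsWithin
      ((chartAt H (a 0)).open_source.mem_nhds (mem_chart_source H (a 0)))
  have hle : 𝓝[>] (0 : ℝ) ≤ 𝓝[≥] 0 := nhdsWithin_mono _ Ioi_subset_Ici_self
  filter_upwards [hle h1, hle h2, ha, self_mem_nhdsWithin] with t h1 h2 h3 ht
  have ht : 0 < t := ht
  have h4 : Metric.infDist (extChartAt I (a 0) (a 0) + t • L)
      (extChartAt I (a 0) '' ((chartAt H (a 0)).source ∩ A)) ≤ ε / 2 * t := by
    refine (Metric.infDist_le_dist_of_mem (mem_image_of_mem (extChartAt I (a 0))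
      (show a t ∈ (chartAt H (a 0)).source ∩ A from ⟨h2, h3⟩))).trans ?_
    rw [dist_eq_norm, norm_sub_rev]
    simpa [sub_add_eq_sub_sub, abs_of_pos ht] using h1
  rw [dist_zero_right, Real.norm_of_nonneg (mul_nonneg (by positivity) Metric.infDist_nonneg)]
  calc t⁻¹ * _ ≤ t⁻¹ * (ε / 2 * t) := by gcongr
    _ = ε / 2 := by field_simp
    _ < ε := half_lt_self hε

/-- An adjacent tangent vector is the initial velocity of a curve that stays in `A`. -/
theorem exists_curve_of_mem_adjacentVectors [I.Boundaryless] {n : ℕ∞} (hn : 1 ≤ n)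
    [IsManifold I n M] {A : Set M} {X : (x : M) → TangentSpace I x} {x : M}
    (hx : (⟨x, X x⟩ : TangentBundle I M) ∈ adjacentVectors I n A) :
    ∃ a : ℝ → M, a 0 = x ∧ (∀ᶠ t in 𝓝[>] (0 : ℝ), a t ∈ A) ∧
      HasMFDerivWithinAt 𝓘(ℝ, ℝ) I a (Ici 0) 0 ((1 : ℝ →L[ℝ] ℝ).smulRight (X (a 0))) := by
  have hn' : (1 : WithTop ℕ∞) ≤ n := by exact_mod_cast hn
  have : IsManifold I 1 M := IsManifold.of_le (n := n) hn'
  obtain ⟨hxA, φ, hφ, hxφ, hlim⟩ := hx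
  have hφ1 : φ ∈ IsManifold.maximalAtlas I 1 M := IsManifold.maximalAtlas_subset_of_le hn' hφ
  simp only at hxA hxφ hlim
  have hs : x ∈ (φ.extend I).source := by rwa [φ.extend_source]
  have hdφ : MDifferentiableAt I 𝓘(ℝ, F) (φ.extend I) x :=
    (φ.contMDiffAt_extend hφ1 hxφ).mdifferentiableAt one_ne_zero
  have hdχ : MDifferentiableAt 𝓘(ℝ, F) I (φ.extend I).symm (φ.extend I x) :=
    ((contMDiffOn_extend_symm hφ1).contMDiffAt (by
      simpa [I.range_eq_univ] using
        φ.extend_image_target_mem_nhds (I := I) hxφ)).mdifferentiableAt one_ne_zero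
  have hleft : (φ.extend I).symm (φ.extend I x) = x := (φ.extend I).left_inv hs
  have hcomp : (mfderiv 𝓘(ℝ, F) I (φ.extend I).symm (φ.extend I x)).comp
      (mfderiv I 𝓘(ℝ, F) (φ.extend I) x) = ContinuousLinearMap.id ℝ F := by
    have h2 : (φ.extend I).symm ∘ φ.extend I =ᶠ[𝓝 x] id := by
      filter_upwards [φ.extend_source_mem_nhds (I := I) hxφ] with y hy
      exact (φ.extend I).left_inv hy
    exact (mfderiv_comp x hdχ hdφ).symm.trans
      ((hasMFDerivAt_id (I := I) x).congr_of_eventuallyEq h2).mfderiv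
  set ψ := φ.extend I with hψ
  obtain ⟨L, hL⟩ : ∃ L : F, L = mfderiv I 𝓘(ℝ, F) ψ x (X x) := ⟨_, rfl⟩
  rw [← hL] at hlim
  -- The distance need not be attained; an excess of `t ^ 2` is negligible against `t`.
  have hsel : ∀ t : ℝ, ∃ y ∈ φ.source ∩ A, 0 < t →
      dist (ψ x + t • L) (ψ y) < Metric.infDist (ψ x + t • L) (ψ '' (φ.source ∩ A)) + t ^ 2 := by
    intro t
    by_cases ht : 0 < t
    · obtain ⟨_, ⟨y, hy, rfl⟩, hd⟩ := (Metric.infDist_lt_iff (s := ψ '' (φ.source ∩ A))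
        ⟨_, mem_image_of_mem ψ ⟨hxφ, hxA⟩⟩).1 (lt_add_of_pos_right
          (Metric.infDist (ψ x + t • L) (ψ '' (φ.source ∩ A))) (pow_pos ht 2))
      exact ⟨y, hy, fun _ => hd⟩
    · exact ⟨x, ⟨hxφ, hxA⟩, fun h => absurd h ht⟩
  choose y hy hyd using hsel
  let b : ℝ → F := fun t => if 0 < t then ψ (y t) else ψ x
  have hb0 : b 0 = ψ x := by simp [b]
  have hbd : HasDerivWithinAt b L (Ici 0) 0 := by
    rw [hasDerivWithinAt_iff_isLittleO, Asymptotics.isLittleO_iff]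
    intro ε hε
    have h1 : ∀ᶠ t : ℝ in 𝓝[>] 0, t < ε / 2 := nhdsWithin_le_nhds (Iio_mem_nhds (half_pos hε))
    have h2 := (Metric.tendsto_nhds.1 hlim) (ε / 2) (half_pos hε)
    rw [← Ioi_insert, nhdsWithin_insert, eventually_sup]
    refine ⟨by simp, ?_⟩
    filter_upwards [h1, h2, self_mem_nhdsWithin] with t h1 h2 ht
    have ht : 0 < t := ht
    rw [dist_zero_right, Real.norm_of_nonneg (mul_nonneg (by positivity) Metric.infDist_nonneg),
      inv_mul_lt_iff₀ ht] at h2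
    have h3 := hyd t ht
    rw [hb0, sub_zero, Real.norm_of_nonneg ht.le]
    simp only [b, if_pos ht]
    rw [dist_comm, dist_eq_norm, sub_add_eq_sub_sub] at h3
    nlinarith
  refine ⟨ψ.symm ∘ b, by simp [hb0, hleft], ?_, ?_⟩
  · filter_upwards [self_mem_nhdsWithin] with t ht
    have ht : 0 < t := ht
    simp only [Function.comp_apply, b, if_pos ht]
    rw [ψ.left_inv (by rw [hψ, φ.extend_source]; exact (hy t).1)]
    exact (hy t).2
  · rw [← hb0] at hdχ
    have h1 := hasMFDerivWithinAt_comp_of_hasDerivWithinAt hdχ hbd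
    -- The fibre of `X z` depends on `z`, so the equality of base points is transported in the model
    -- space.
    have hX : ∀ z, z = x → (X z : F) = X x := by
      rintro _ rfl
      rfl
    have h2 : (mfderiv 𝓘(ℝ, F) I ψ.symm (b 0) L : F) = X ((ψ.symm ∘ b) 0) := by
      rw [hX _ (by rw [Function.comp_apply, hb0, hleft]), hb0, hL]
      exact congrArg (fun T : F →L[ℝ] F => T (X x)) hcomp
    exact h1.congr_mfderiv (congrArg (ContinuousLinearMap.smulRight (1 : ℝ →L[ℝ] ℝ)) h2)

/-- **Nagumo's theorem** on a manifold without boundary: if a `C^1` vector field is adjacent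
tangent to a closed set `A`, then its integral curves that start in `A` stay in `A`. -/
theorem IsAdjacentTangent.mem_of_isMIntegralCurveOn [CompleteSpace F] [I.Boundaryless] {n : ℕ∞}
    (hn : 1 ≤ n) [IsManifold I n M] [IsManifold I 1 M] {A : Set M} (hA : IsClosed A)
    {X : (x : M) → TangentSpace I x}
    (hX : ContMDiff I I.tangent 1 (fun x => (⟨x, X x⟩ : TangentBundle I M)))
    (htan : IsAdjacentTangent I n X A) {γ : ℝ → M} {T : ℝ} (hT : 0 ≤ T)
    (hγ : IsMIntegralCurveOn γ X (Icc 0 T)) (h0 : γ 0 ∈ A) : γ T ∈ A := by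
  suffices h : Icc 0 T ⊆ γ ⁻¹' A from h ⟨hT, le_rfl⟩
  -- Continuous induction: the times spent in `A` form a closed set, and it remains to advance a
  -- little from each of them.
  refine IsClosed.Icc_subset_of_forall_mem_nhdsWithin ?_ h0 ?_
  · rw [inter_comm]
    exact hγ.continuousOn.preimage_isClosed_of_isClosed isClosed_Icc hA
  rintro t₀ ⟨ht₀A, ht₀⟩
  have ht₀A : γ t₀ ∈ A := ht₀A
  set x₀ := γ t₀ with hx₀
  set ψ := extChartAt I x₀ with hψ
  let f : F → F := fun y => tangentCoordChange I (ψ.symm y) x₀ (ψ.symm y) (X (ψ.symm y))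
  have hf : ContDiffAt ℝ 1 f (ψ x₀) := by
    have h := hX x₀
    rw [contMDiffAt_iff] at h
    exact (h.2.contDiffAt (by rw [I.range_eq_univ]; exact univ_mem)).snd
  obtain ⟨K, N, hN, hlip⟩ := hf.exists_lipschitzOnWith
  have hbdd : ∀ᶠ y in 𝓝 (ψ x₀), ‖f y‖ < ‖f (ψ x₀)‖ + 1 :=
    hf.continuousAt.norm.eventually_lt continuousAt_const (lt_add_one _)
  have htgt : ψ.target ∈ 𝓝 (ψ x₀) := extChartAt_target_mem_nhds x₀
  obtain ⟨R, hR, hball⟩ := Metric.nhds_basis_closedBall.mem_iff.1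
    (inter_mem (inter_mem hN hbdd) htgt)
  -- Cutting with a closed ball inside the chart target makes the image of `A` closed in the whole
  -- of `F`.
  let C : Set F := Metric.closedBall (ψ x₀) R ∩ ψ.symm ⁻¹' A
  have hC : IsClosed C :=
    ((continuousOn_extChartAt_symm x₀).mono fun y hy =>
      (hball hy).2).preimage_isClosed_of_isClosed Metric.isClosed_closedBall hA
  have hsrcM : ∀ x ∈ ψ.source, MDifferentiableAt I 𝓘(ℝ, F) ψ x := fun x hx =>
    mdifferentiableAt_extChartAt (by rwa [hψ, extChartAt_source] at hx)
  have hfX : ∀ x ∈ ψ.source, (mfderiv I 𝓘(ℝ, F) ψ x (X x) : F) = f (ψ x) := by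
    intro x hx
    simp only [f]
    rw [ψ.left_inv hx]
    rw [hψ, extChartAt_source] at hx
    rw [(hasMFDerivAt_extChartAt hx).mfderiv, mfderiv_chartAt_eq_tangentCoordChange hx]
    rfl
  have hcont : ContinuousWithinAt γ (Icc 0 T) t₀ := hγ.continuousWithinAt ⟨ht₀.1, ht₀.2.le⟩
  have hsub : Icc 0 T ∈ 𝓝[≥] t₀ :=
    mem_of_superset (Icc_mem_nhdsGE ht₀.2) (Icc_subset_Icc_left ht₀.1)
  have hcont' : ContinuousWithinAt γ (Ici t₀) t₀ := hcont.mono_of_mem_nhdsWithin hsub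
  have hu0 : ContinuousWithinAt (ψ ∘ γ) (Ici t₀) t₀ :=
    (continuousAt_extChartAt x₀).comp_continuousWithinAt hcont'
  have hev : ∀ᶠ t in 𝓝[≥] t₀, γ t ∈ ψ.source ∧ ψ (γ t) ∈ Metric.closedBall (ψ x₀) R ∧
      t ∈ Icc 0 T :=
    (hcont'.tendsto.eventually_mem (extChartAt_source_mem_nhds x₀)).and
      ((hu0.tendsto.eventually_mem (Metric.closedBall_mem_nhds _ hR)).and hsub)
  obtain ⟨t₁, ht₁, hIcc⟩ := (mem_nhdsGE_iff_exists_Icc_subset).1 hev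
  have hB : 0 < ‖f (ψ x₀)‖ + 1 := by positivity
  have hsmall : ∀ᶠ t in 𝓝[>] t₀, (‖f (ψ x₀)‖ + 1 + 1) * (t - t₀) < R := by
    have hc : Continuous fun t : ℝ => (‖f (ψ x₀)‖ + 1 + 1) * (t - t₀) := by fun_prop
    have := hc.tendsto t₀
    rw [sub_self, mul_zero] at this
    exact nhdsWithin_le_nhds (this.eventually (Iio_mem_nhds hR))
  filter_upwards [hsmall, Ioo_mem_nhdsGT ht₁] with t ht ht'
  have hI : ∀ σ ∈ Icc 0 (t - t₀), σ + t₀ ∈ Icc t₀ t₁ := fun σ hσ =>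
    ⟨by linarith [hσ.1], by linarith [hσ.2, ht'.2]⟩
  let u : ℝ → F := fun σ => ψ (γ (σ + t₀))
  have hu00 : u 0 = ψ x₀ := by simp [u, hx₀]
  have hmain : u (t - t₀) ∈ C := by
    refine mem_of_subtangent (f := f) (R := R) (K := K) (M := ‖f (ψ x₀)‖ + 1) hC
      (sub_nonneg.2 ht'.1.le) K.2 hB.le ?_ ?_ ?_ ?_ ?_ ht ?_
    · intro σ hσ
      have h1 := hIcc (hI σ hσ)
      have h2 : ContinuousWithinAt γ (Icc t₀ t₁) (σ + t₀) :=
        (hγ.continuousWithinAt h1.2.2).mono fun τ hτ => (hIcc hτ).2.2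
      exact ContinuousAt.comp_continuousWithinAt (f := fun τ : ℝ => γ (τ + t₀)) (g := ψ)
        (continuousAt_extChartAt' h1.1)
        (ContinuousWithinAt.comp (f := fun τ : ℝ => τ + t₀) h2 (by fun_prop) hI)
    · intro σ hσ
      have h1 := hIcc (hI σ ⟨hσ.1, hσ.2.le⟩)
      have h2 := hasDerivWithinAt_comp_of_hasMFDerivWithinAt (hsrcM _ h1.1) (hfX _ h1.1)
        (hγ _ h1.2.2)
      have h3 : Icc 0 T ∈ 𝓝[≥] (σ + t₀) :=
        mem_of_superset (Icc_mem_nhdsGE (lt_sub_iff_add_lt.1 hσ.2)) (Icc_subset_Icc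
          (add_nonneg hσ.1 ht₀.1) (hIcc ⟨ht'.1.le, ht'.2.le⟩).2.2.2)
      have h4 := h2.mono_of_mem_nhdsWithin h3
      have h5 := h4.scomp σ ((hasDerivWithinAt_id σ (Ici σ)).add_const t₀) (fun τ hτ => by
        simpa using hτ)
      simpa [u, Function.comp_def] using h5
    · rw [hu00]
      refine ⟨Metric.mem_closedBall_self hR.le, ?_⟩
      rw [mem_preimage, extChartAt_to_inv]
      exact ht₀A
    · intro σ hσ y hy hyR
      have h1 := hball (hIcc (hI σ hσ)).2.1
      have h2 := hball hy.1
      exact hlip.norm_sub_le h1.1.1 h2.1.1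
    · intro y hy _
      exact (hball hy.1).1.2.le
    · intro y hy hyR ε hε
      rw [hu00] at hyR
      have hyt : y ∈ ψ.target := (hball hy.1).2
      -- Adjacency is given in an unspecified chart; a curve in `A` carries it over to `ψ`.
      obtain ⟨a, ha0, haA, had⟩ := exists_curve_of_mem_adjacentVectors hn (htan _ hy.2)
      have hsrc : a 0 ∈ ψ.source := by rw [ha0]; exact ψ.map_target hyt
      have hψa : ψ (a 0) = y := by rw [ha0, ψ.right_inv hyt]
      have h1 := hasDerivWithinAt_comp_of_hasMFDerivWithinAt (hsrcM _ hsrc) (hfX _ hsrc) had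
      have h2 : ∀ᶠ h in 𝓝[≥] (0 : ℝ), a h ∈ ψ.source :=
        had.1.preimage_mem_nhdsWithin ((isOpen_extChartAt_source x₀).mem_nhds hsrc)
      have h3 : ∀ᶠ h in 𝓝[≥] (0 : ℝ), ψ (a h) ∈ Metric.ball (ψ x₀) R :=
        h1.continuousWithinAt.preimage_mem_nhdsWithin (Metric.isOpen_ball.mem_nhds (by
          rw [Function.comp_apply, hψa, mem_ball_iff_norm]; exact hyR))
      have h4 := (hasDerivWithinAt_iff_isLittleO.1 h1).def hε
      have hle : 𝓝[>] (0 : ℝ) ≤ 𝓝[≥] 0 := nhdsWithin_mono _ Ioi_subset_Ici_self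
      filter_upwards [hle h2, hle h3, hle h4, haA, self_mem_nhdsWithin] with h h2 h3 h4 h5 hh
      have hh : 0 < h := hh
      refine ⟨ψ (a h), ⟨Metric.ball_subset_closedBall h3, ?_⟩, ?_⟩
      · rw [mem_preimage, ψ.left_inv h2]
        exact h5
      · simpa [hψa, abs_of_pos hh] using h4
  have h1 := hmain.2
  simp only [u, sub_add_cancel] at h1
  rw [mem_preimage, ψ.left_inv (hIcc ⟨ht'.1.le, ht'.2.le⟩).1] at h1
  exact h1

end Tangency

/-! ### Calculus for second-order expansions -/

/-- A second order Taylor estimate: if `p' = q` to the right of `0` and `q'(0) = w`, then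
`p(t) = p(0) + t q(0) + (t² / 2) w + o(t²)`. -/
theorem eventually_norm_sub_taylor_two_le {E : Type*} [NormedAddCommGroup E] [NormedSpace ℝ E]
    {p q : ℝ → E} {w : E} {δ : ℝ} (hδ : 0 < δ)
    (hp : ∀ t ∈ Ico 0 δ, HasDerivWithinAt p (q t) (Ico 0 δ) t)
    (hq : HasDerivWithinAt q w (Ici 0) 0) {η : ℝ} (hη : 0 < η) :
    ∀ᶠ t : ℝ in 𝓝[>] 0, ‖p t - (p 0 + t • q 0 + ((1 / 2 : ℝ) * t ^ 2) • w)‖ ≤ η * t ^ 2 := by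
  have h1 := (hasDerivWithinAt_iff_isLittleO.1 hq).def hη
  obtain ⟨ρ, hρ, hIcc⟩ := (mem_nhdsGE_iff_exists_Icc_subset).1 h1
  have hρ : 0 < ρ := hρ
  filter_upwards [Ioo_mem_nhdsGT (lt_min hδ hρ)] with t ht
  have htδ : t < δ := ht.2.trans_le (min_le_left _ _)
  have htρ : t < ρ := ht.2.trans_le (min_le_right _ _)
  have hder : ∀ x ∈ Icc 0 t, HasDerivWithinAt
      (fun x : ℝ => p x - (p 0 + x • q 0 + ((1 / 2 : ℝ) * x ^ 2) • w))
      (q x - (q 0 + x • w)) (Icc 0 t) x := by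
    intro x hx
    have h2 : HasDerivWithinAt p (q x) (Icc 0 t) x :=
      (hp x ⟨hx.1, hx.2.trans_lt htδ⟩).mono (Icc_subset_Ico_right htδ)
    have h3 : HasDerivWithinAt (fun x : ℝ => x • q 0) ((1 : ℝ) • q 0) (Icc 0 t) x :=
      (hasDerivWithinAt_id x _).smul_const _
    have h4 : HasDerivWithinAt (fun x : ℝ => (1 / 2 : ℝ) * x ^ 2) x (Icc 0 t) x := by
      have := ((hasDerivAt_pow 2 x).const_mul (1 / 2 : ℝ)).hasDerivWithinAt (s := Icc 0 t)
      refine this.congr_deriv ?_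
      norm_num
      ring
    have h5 := h2.sub ((h3.const_add (p 0)).add (h4.smul_const w))
    rw [one_smul] at h5
    exact h5
  -- The mean value inequality for the remainder, whose derivative at `x ≤ t` is at most `η * x` by
  -- differentiability of `q` at `0`.
  have h6 := norm_image_sub_le_of_norm_deriv_le_segment' hder (C := η * t) (fun x hx => by
    have h7 := hIcc ⟨hx.1, (hx.2.trans htρ).le⟩
    simp only [mem_ofPred_eq, sub_zero, Real.norm_of_nonneg hx.1] at h7
    rw [← sub_sub]
    exact h7.trans (by gcongr; exact hx.2.le)) t ⟨ht.1.le, le_rfl⟩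
  simpa [pow_two, mul_assoc] using h6

/-- The manifold derivative of a map to a product of normed spaces, componentwise. -/
theorem mfderiv_prodMk_space_apply {F G₁ G₂ H M : Type*} [NormedAddCommGroup F] [NormedSpace ℝ F]
    [NormedAddCommGroup G₁] [NormedSpace ℝ G₁] [NormedAddCommGroup G₂] [NormedSpace ℝ G₂]
    [TopologicalSpace H] {I : ModelWithCorners ℝ F H} [TopologicalSpace M] [ChartedSpace H M]
    {f : M → G₁} {g : M → G₂} {x : M} (hf : MDifferentiableAt I 𝓘(ℝ, G₁) f x)
    (hg : MDifferentiableAt I 𝓘(ℝ, G₂) g x) (w : TangentSpace I x) :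
    (mfderiv I 𝓘(ℝ, G₁ × G₂) (fun y => (f y, g y)) x w : G₁ × G₂) =
      (mfderiv I 𝓘(ℝ, G₁) f x w, mfderiv I 𝓘(ℝ, G₂) g x w) := by
  have h : HasMFDerivAt I 𝓘(ℝ, G₁ × G₂) (fun y => (f y, g y)) x
      (ContinuousLinearMap.prod (M₁ := F) (M₂ := G₁) (M₃ := G₂)
        (mfderiv I 𝓘(ℝ, G₁) f x) (mfderiv I 𝓘(ℝ, G₂) g x)) :=
    ⟨hf.continuousAt.prodMk hg.continuousAt, hf.hasMFDerivAt.2.prodMk hg.hasMFDerivAt.2⟩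
  exact congrArg (fun T : F →L[ℝ] G₁ × G₂ => T w) h.mfderiv

/-! ### Integral curves of a spray: admissible velocities and time reversal -/

section Spray

variable {E : Type*} [NormedAddCommGroup E] [NormedSpace ℝ E]
  {B : Type*} [TopologicalSpace B] [ChartedSpace E B] [IsManifold 𝓘(ℝ, E) 2 B]

theorem mdifferentiable_fiberSmul (c : ℝ) :
    MDifferentiable 𝓘(ℝ, E).tangent 𝓘(ℝ, E).tangent (fiberSmul (E := E) (B := B) c) := by
  intro v
  have h := (mdifferentiableAt_id (I := 𝓘(ℝ, E).tangent) (x := v))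
  rw [mdifferentiableAt_totalSpace] at h ⊢
  refine ⟨h.1, ?_⟩
  have h2 := h.2.const_smul c
  refine h2.congr_of_eventuallyEq (.of_forall fun u => ?_)
  exact map_smul (tangentCoordChange 𝓘(ℝ, E) u.proj v.proj u.proj) c u.2

/-- The fibre component of the tangent map of a chart is differentiable. -/
theorem mdifferentiableAt_mfderiv_chartAt (v : TangentBundle 𝓘(ℝ, E) B) :
    MDifferentiableAt 𝓘(ℝ, E).tangent 𝓘(ℝ, E)
      (fun u : TangentBundle 𝓘(ℝ, E) B =>
        (mfderiv 𝓘(ℝ, E) 𝓘(ℝ, E) (chartAt E v.proj) u.proj u.2 : E)) v := by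
  have h := (mdifferentiableAt_id (I := 𝓘(ℝ, E).tangent) (x := v))
  rw [mdifferentiableAt_totalSpace] at h
  refine h.2.congr_of_eventuallyEq ?_
  have hsrc : ∀ᶠ u in 𝓝 v, u.proj ∈ (chartAt E v.proj).source :=
    h.1.continuousAt.eventually_mem (chart_source_mem_nhds E v.proj)
  filter_upwards [hsrc] with u hu
  rw [mfderiv_chartAt_eq_tangentCoordChange hu]
  rfl

/-- The projection to `B` of an integral curve `γ` of a spray has velocity `γ`. -/
theorem IsSpray.hasMFDerivWithinAt_proj {r : ℕ∞}
    {s : (v : TangentBundle 𝓘(ℝ, E) B) → TangentSpace 𝓘(ℝ, E).tangent v} (hs : IsSpray r s)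
    {γ : ℝ → TangentBundle 𝓘(ℝ, E) B} {J : Set ℝ} (hγ : IsMIntegralCurveOn γ s J) {t : ℝ}
    (ht : t ∈ J) :
    HasMFDerivWithinAt 𝓘(ℝ, ℝ) 𝓘(ℝ, E) (fun τ => (γ τ).proj) J t
      ((1 : ℝ →L[ℝ] ℝ).smulRight (γ t).2) := by
  have hproj : MDifferentiableAt 𝓘(ℝ, E).tangent 𝓘(ℝ, E)
      (fun u : TangentBundle 𝓘(ℝ, E) B => u.proj) (γ t) := Bundle.mdifferentiableAt_proj _
  refine (hproj.hasMFDerivAt.comp_hasMFDerivWithinAt t (hγ t ht)).congr_mfderiv ?_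
  refine ContinuousLinearMap.ext fun (c : ℝ) => ?_
  exact (map_smul (mfderiv 𝓘(ℝ, E).tangent 𝓘(ℝ, E)
    (fun u : TangentBundle 𝓘(ℝ, E) B => u.proj) (γ t)) c (s (γ t))).trans
      (congrArg (c • ·) (hs.second_order (γ t)))

/-- The initial velocity of a geodesic that stays in `S` for small positive times is
admissible. -/
theorem IsSpray.mem_admissibleSet_of_isMIntegralCurveOn {k : ℕ∞} (hk : 1 ≤ k)
    [IsManifold 𝓘(ℝ, E) k B] {r : ℕ∞}
    {s : (v : TangentBundle 𝓘(ℝ, E) B) → TangentSpace 𝓘(ℝ, E).tangent v} (hs : IsSpray r s)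
    {S : Set B} {γ : ℝ → TangentBundle 𝓘(ℝ, E) B} {ε : ℝ} (hε : 0 < ε)
    (hγ : IsMIntegralCurveOn γ s (Ico 0 ε)) (hS : ∀ t ∈ Ico 0 ε, (γ t).proj ∈ S) :
    γ 0 ∈ admissibleSet k s S := by
  have h0 : (0 : ℝ) ∈ Ico 0 ε := ⟨le_rfl, hε⟩
  have hSε : ∀ᶠ t in 𝓝[>] (0 : ℝ), (γ t).proj ∈ S := by
    filter_upwards [Ioo_mem_nhdsGT hε] with t ht using hS t ⟨ht.1.le, ht.2⟩
  have hg := fun t ht => hs.hasMFDerivWithinAt_proj hγ (t := t) ht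
  refine ⟨hS 0 h0, hS 0 h0, mem_adjacentVectors_of_curve hk (a := fun t => (γ t).proj)
    (hS 0 h0) hSε ((hg 0 h0).mono_of_mem_nhdsWithin (Ico_mem_nhdsGE hε)), ?_⟩
  set φ := chartAt E (γ 0).proj with hφ
  have hφsrc : (γ 0).proj ∈ φ.source := mem_chart_source E _
  refine ⟨φ, IsManifold.chart_mem_maximalAtlas _, hφsrc, ?_⟩
  have hφd : ∀ x ∈ φ.source, MDifferentiableAt 𝓘(ℝ, E) 𝓘(ℝ, E) φ x := fun x hx =>
    mdifferentiableAt_atlas (chart_mem_atlas E _) hx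
  have hproj : MDifferentiableAt 𝓘(ℝ, E).tangent 𝓘(ℝ, E)
      (fun u : TangentBundle 𝓘(ℝ, E) B => u.proj) (γ 0) := Bundle.mdifferentiableAt_proj _
  have hd := mfderiv_prodMk_space_apply ((hφd _ hφsrc).comp (γ 0) hproj)
    (mdifferentiableAt_mfderiv_chartAt (γ 0)) (s (γ 0))
  let q : ℝ → E := fun t => mfderiv 𝓘(ℝ, E) 𝓘(ℝ, E) φ (γ t).proj (γ t).2
  obtain ⟨w, hw⟩ : ∃ w : E × E, w = mfderiv 𝓘(ℝ, E).tangent 𝓘(ℝ, E × E) (tangentChart φ) (γ 0)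
    (s (γ 0)) := ⟨_, rfl⟩
  have hw' := hw.trans hd
  -- The first component is the second-order condition on `s`; the second, below, is the derivative
  -- at `0` of the chart velocity `q`.
  have hw1 : w.1 = q 0 := by
    rw [hw']
    exact (mfderiv_comp_apply (γ 0) (hφd _ hφsrc) hproj (s (γ 0))).trans
      (congrArg (mfderiv 𝓘(ℝ, E) 𝓘(ℝ, E) φ (γ 0).proj) (hs.second_order (γ 0)))
  have hq : HasDerivWithinAt q w.2 (Ici 0) 0 := by
    have := hasDerivWithinAt_comp_of_hasMFDerivWithinAt
      (mdifferentiableAt_mfderiv_chartAt (γ 0)) (L := w.2) (by rw [hw']) (hγ 0 h0)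
    exact this.mono_of_mem_nhdsWithin (Ico_mem_nhdsGE hε)
  have hsrc : ∀ᶠ t in 𝓝[≥] (0 : ℝ), (γ t).proj ∈ φ.source :=
    ((hg 0 h0).1.mono_of_mem_nhdsWithin (Ico_mem_nhdsGE hε)).tendsto.eventually_mem
      (φ.open_source.mem_nhds hφsrc)
  obtain ⟨ρ, hρ, hIcc⟩ := (mem_nhdsGE_iff_exists_Icc_subset).1 hsrc
  have hρ : 0 < ρ := hρ
  have hδ : 0 < min ε ρ := lt_min hε hρ
  have hsub : Ico 0 (min ε ρ) ⊆ Ico 0 ε := Ico_subset_Ico_right (min_le_left _ _)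
  have hsrc' : ∀ t ∈ Ico 0 (min ε ρ), (γ t).proj ∈ φ.source := fun t ht =>
    hIcc ⟨ht.1, (ht.2.trans_le (min_le_right _ _)).le⟩
  have hp : ∀ t ∈ Ico 0 (min ε ρ),
      HasDerivWithinAt (fun t => φ (γ t).proj) (q t) (Ico 0 (min ε ρ)) t := fun t ht =>
    hasDerivWithinAt_comp_of_hasMFDerivWithinAt (hφd _ (hsrc' t ht)) rfl
      ((hg t (hsub ht)).mono hsub)
  intro vφ wφ
  rw [show wφ = w from hw.symm]
  refine ⟨hw1, ?_⟩
  rw [Metric.tendsto_nhds]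
  intro η hη
  filter_upwards [eventually_norm_sub_taylor_two_le hδ hp hq (half_pos hη), Ioo_mem_nhdsGT hδ]
    with t ht1 ht2
  have ht : 0 < t := ht2.1
  have ht3 : t ∈ Ico 0 (min ε ρ) := ⟨ht2.1.le, ht2.2⟩
  have h4 : Metric.infDist (φ (γ 0).proj + t • vφ + ((1 / 2 : ℝ) * t ^ 2) • w.2)
      (φ '' (φ.source ∩ S)) ≤ η / 2 * t ^ 2 := by
    refine (Metric.infDist_le_dist_of_mem (mem_image_of_mem φ
      (show (γ t).proj ∈ φ.source ∩ S from ⟨hsrc' t ht3, hS t (hsub ht3)⟩))).trans ?_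
    rw [dist_eq_norm, norm_sub_rev]
    exact ht1
  rw [dist_zero_right, Real.norm_of_nonneg (mul_nonneg (by positivity) Metric.infDist_nonneg)]
  calc (t ^ 2)⁻¹ * _ ≤ (t ^ 2)⁻¹ * (η / 2 * t ^ 2) := by gcongr
    _ = η / 2 := by field_simp
    _ < η := half_lt_self hη

/-- The time reversal of the canonical lift of a geodesic. -/
theorem IsSpray.isMIntegralCurveOn_reverse {r : ℕ∞}
    {s : (v : TangentBundle 𝓘(ℝ, E) B) → TangentSpace 𝓘(ℝ, E).tangent v} (hs : IsSpray r s)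
    {γ : ℝ → TangentBundle 𝓘(ℝ, E) B} {J : Set ℝ} (hγ : IsMIntegralCurveOn γ s J) (τ : ℝ) :
    IsMIntegralCurveOn (fun t => fiberSmul (-1) (γ (τ - t))) s {t | τ - t ∈ J} := by
  -- Reversing time gives an integral curve of `-s`, which homogeneity with `c = -1` turns into one
  -- of `s` after negation in the fibres.
  have h1 : IsMIntegralCurveOn (fun t => γ (τ - t)) ((-1 : ℝ) • s) {t | τ - t ∈ J} := by
    have := (hγ.comp_add τ).comp_mul (-1)
    simpa [Function.comp_def, sub_eq_add_neg, add_comm] using this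
  intro t ht
  refine ((mdifferentiable_fiberSmul (-1) _).hasMFDerivAt.comp_hasMFDerivWithinAt t
    (h1 t ht)).congr_mfderiv ?_
  refine ContinuousLinearMap.ext fun (c : ℝ) => ?_
  exact (map_smul (mfderiv 𝓘(ℝ, E).tangent 𝓘(ℝ, E).tangent
    (fiberSmul (E := E) (B := B) (-1)) (γ (τ - t))) c ((-1 : ℝ) • s (γ (τ - t)))).trans
      (congrArg (c • ·) (hs.homogeneous (-1) (γ (τ - t))).symm)

end Spray

theorem ENat.one_le_sub_one {k : ℕ∞} (hk : 2 ≤ k) : 1 ≤ k - 1 :=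
  le_trans (show (1 : ℕ∞) ≤ 2 - 1 from le_rfl) (tsub_le_tsub_right hk 1)

/-! ### Invariance and tangency -/

section Invariance

variable {E : Type*} [NormedAddCommGroup E] [NormedSpace ℝ E]
  {B : Type*} [TopologicalSpace B] [ChartedSpace E B]

/-- The tangent bundle of a `C^k` manifold, `k ≥ 1`, is a `C^{k-1}` manifold. -/
theorem isManifold_tangentBundle {k : ℕ∞} (hk : 1 ≤ k) [IsManifold 𝓘(ℝ, E) k B]
    [IsManifold 𝓘(ℝ, E) 1 B] :
    IsManifold 𝓘(ℝ, E).tangent (k - 1 : ℕ∞) (TangentBundle 𝓘(ℝ, E) B) := by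
  have hk' : ((k - 1 : ℕ∞) : WithTop ℕ∞) + 1 = k := by
    exact_mod_cast congrArg (fun j : ℕ∞ => (j : WithTop ℕ∞)) (tsub_add_cancel_of_le hk)
  have : IsManifold 𝓘(ℝ, E) (((k - 1 : ℕ∞) : WithTop ℕ∞) + 1) B := by rwa [hk']
  have : IsManifold 𝓘(ℝ, E) ((k - 1 : ℕ∞) : WithTop ℕ∞) B :=
    .of_le (n := ((k - 1 : ℕ∞) : WithTop ℕ∞) + 1) le_self_add
  have : ContMDiffVectorBundle ((k - 1 : ℕ∞) : WithTop ℕ∞) E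
    (TangentSpace 𝓘(ℝ, E) : B → Type _) 𝓘(ℝ, E) := TangentBundle.contMDiffVectorBundle
  exact Bundle.TotalSpace.isManifold _ _

variable [IsManifold 𝓘(ℝ, E) 2 B] {r : ℕ∞}
  {s : (v : TangentBundle 𝓘(ℝ, E) B) → TangentSpace 𝓘(ℝ, E).tangent v}

theorem IsSpray.contMDiff_one (hs : IsSpray r s) (hr : 1 ≤ r) :
    ContMDiff 𝓘(ℝ, E).tangent 𝓘(ℝ, E).tangent.tangent 1
      (fun v => (⟨v, s v⟩ : TangentBundle 𝓘(ℝ, E).tangent (TangentBundle 𝓘(ℝ, E) B))) :=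
  hs.contMDiff.of_le (by exact_mod_cast hr)

theorem IsSpray.exists_isMIntegralCurveOn [CompleteSpace E] (hs : IsSpray r s) (hr : 1 ≤ r)
    (v : TangentBundle 𝓘(ℝ, E) B) :
    ∃ γ : ℝ → TangentBundle 𝓘(ℝ, E) B, γ 0 = v ∧
      ∃ ε > 0, IsMIntegralCurveOn γ s (Ioo (-ε) ε) := by
  obtain ⟨γ, h0, hγ⟩ := exists_isMIntegralCurveAt_of_contMDiffAt_boundaryless 0
    ((hs.contMDiff_one hr) v)
  obtain ⟨ε, hε, h⟩ := isMIntegralCurveAt_iff'.1 hγ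
  refine ⟨γ, h0, ε, hε, ?_⟩
  simpa [Real.ball_eq_Ioo] using h

/-- A closed admissible set to which the spray is adjacent tangent is symmetric. -/
theorem IsSpray.fiberSmul_neg_one_mem [CompleteSpace E] {k : ℕ∞} (hk : 2 ≤ k)
    [IsManifold 𝓘(ℝ, E) k B] (hs : IsSpray r s) (hr : 1 ≤ r) {S : Set B}
    (hA : IsClosed (admissibleSet k s S))
    (htan : IsAdjacentTangent 𝓘(ℝ, E).tangent (k - 1) s (admissibleSet k s S))
    {v : TangentBundle 𝓘(ℝ, E) B} (hv : v ∈ admissibleSet k s S) :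
    fiberSmul (-1) v ∈ admissibleSet k s S := by
  have hk1 : 1 ≤ k := le_trans (by norm_num) hk
  have := isManifold_tangentBundle (E := E) (B := B) hk1
  obtain ⟨γ, rfl, ε, hε, hγ⟩ := hs.exists_isMIntegralCurveOn hr v
  have hfwd : ∀ t ∈ Ico 0 ε, γ t ∈ admissibleSet k s S := fun t ht =>
    htan.mem_of_isMIntegralCurveOn (ENat.one_le_sub_one hk) hA (hs.contMDiff_one hr) ht.1
      (hγ.mono fun σ hσ => ⟨by linarith [hσ.1], by linarith [hσ.2, ht.2]⟩) hv
  -- Run backwards from time `τ > 0`, the geodesic retraces points already known to lie in `S`, so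
  -- `-γ τ` is admissible. The case `τ = 0` follows in the limit because the admissible set is
  -- closed.
  have hneg : ∀ τ ∈ Ioo 0 ε, fiberSmul (-1) (γ τ) ∈ admissibleSet k s S := by
    intro τ hτ
    have h1 := hs.mem_admissibleSet_of_isMIntegralCurveOn hk1 (S := S) hτ.1
      ((hs.isMIntegralCurveOn_reverse hγ τ).mono fun σ hσ =>
        ⟨by linarith [hσ.2], by linarith [hσ.1, hτ.2]⟩)
      (fun σ hσ => (hfwd (τ - σ) ⟨by linarith [hσ.2], by linarith [hσ.1, hτ.2]⟩).1)
    simpa using h1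
  have hcont : ContinuousAt (fun t => fiberSmul (-1) (γ t)) 0 :=
    ((mdifferentiable_fiberSmul (-1)).continuous.continuousAt).comp
      (hγ.continuousOn.continuousAt (Ioo_mem_nhds (by linarith) hε))
  exact hA.mem_of_tendsto (b := 𝓝[>] (0 : ℝ)) (hcont.tendsto.mono_left nhdsWithin_le_nhds)
    (by filter_upwards [Ioo_mem_nhdsGT hε] with t ht using hneg t ht)

/-- Nagumo's theorem applies to the canonical lift for `t ≥ 0`. For `t ≤ 0` it applies to the
reversed lift, whose start `-v` is admissible by symmetry. -/
theorem IsSpray.isSprayInvariant_of_isAdjacentTangent [CompleteSpace E] {k : ℕ∞} (hk : 2 ≤ k)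
    [IsManifold 𝓘(ℝ, E) k B] (hs : IsSpray r s) (hr : 1 ≤ r) {S : Set B}
    (hA : IsClosed (admissibleSet k s S))
    (htan : IsAdjacentTangent 𝓘(ℝ, E).tangent (k - 1) s (admissibleSet k s S)) :
    IsSprayInvariant k s S := by
  have hk1 : 1 ≤ k := le_trans (by norm_num) hk
  have := isManifold_tangentBundle (E := E) (B := B) hk1
  intro J g hJ _ h0 hg _ hv t ht
  rcases le_total 0 t with h | h
  · exact (htan.mem_of_isMIntegralCurveOn (ENat.one_le_sub_one hk) hA
      (hs.contMDiff_one hr) h (IsMIntegralCurveOn.mono hg (hJ.out h0 ht)) hv).1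
  · have h1 := htan.mem_of_isMIntegralCurveOn (ENat.one_le_sub_one hk) hA
      (hs.contMDiff_one hr) (neg_nonneg.2 h) ((hs.isMIntegralCurveOn_reverse hg 0).mono
        fun σ hσ => hJ.out ht h0 ⟨by linarith [hσ.2], by linarith [hσ.1]⟩)
      (by simpa using hs.fiberSmul_neg_one_mem hk hr hA htan hv)
    simp only [sub_neg_eq_add, zero_add] at h1
    exact h1.1

/-- The integral curve through an admissible vector remains admissible, since each of its later
values starts a geodesic that stays in `S`; its velocity is therefore adjacent tangent. -/
theorem IsSprayInvariant.isAdjacentTangent [CompleteSpace E] {k : ℕ∞} (hk : 2 ≤ k)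
    [IsManifold 𝓘(ℝ, E) k B] (hs : IsSpray r s) (hr : 1 ≤ r) {S : Set B}
    (hS : IsSprayInvariant k s S) :
    IsAdjacentTangent 𝓘(ℝ, E).tangent (k - 1) s (admissibleSet k s S) := by
  have hk1 : 1 ≤ k := le_trans (by norm_num) hk
  have := isManifold_tangentBundle (E := E) (B := B) hk1
  intro v hv
  obtain ⟨γ, rfl, ε, hε, hγ⟩ := hs.exists_isMIntegralCurveOn hr v
  have h0 : (0 : ℝ) ∈ Ioo (-ε) ε := ⟨by linarith, hε⟩
  -- Derivatives within an open interval are unique, so `γ` is the canonical lift of its own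
  -- projection.
  have hlift : ∀ t ∈ Ioo (-ε) ε,
      canonicalLift (E := E) (fun τ => (γ τ).proj) (Ioo (-ε) ε) t = γ t := by
    intro t ht
    have h1 := (hs.hasMFDerivWithinAt_proj hγ ht).mfderivWithin
      (isOpen_Ioo.uniqueMDiffWithinAt ht)
    have h2 : (mfderivWithin 𝓘(ℝ, ℝ) 𝓘(ℝ, E) (fun τ => (γ τ).proj) (Ioo (-ε) ε) t (1 : ℝ) : E) =
        (γ t).2 :=
      (congrArg (fun T : ℝ →L[ℝ] E => T 1) h1).trans (one_smul ℝ ((γ t).2 : E))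
    exact congrArg (fun w : E => (⟨(γ t).proj, w⟩ : TangentBundle 𝓘(ℝ, E) B)) h2
  have hgeo : IsGeodesicOn s (fun τ => (γ τ).proj) (Ioo (-ε) ε) := by
    intro t ht
    have hz : ∀ z z', z = z' → (s z : E × E) = s z' := by
      rintro z _ rfl
      rfl
    exact ((hγ t ht).congr_of_eventuallyEq (eventually_of_mem self_mem_nhdsWithin hlift)
      (hlift t ht)).congr_mfderiv (congrArg (ContinuousLinearMap.smulRight (1 : ℝ →L[ℝ] ℝ))
        (hz _ _ (hlift t ht).symm))
  have hγS : ∀ t ∈ Ioo (-ε) ε, (γ t).proj ∈ S :=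
    hS _ _ ordConnected_Ioo ⟨0, h0, ε / 2, ⟨by linarith, by linarith⟩, by positivity⟩ h0 hgeo hv.1
      (by rw [hlift 0 h0]; exact hv)
  refine mem_adjacentVectors_of_curve (ENat.one_le_sub_one hk) hv ?_
    ((hγ 0 h0).mono_of_mem_nhdsWithin (nhdsWithin_le_nhds (Ioo_mem_nhds h0.1 h0.2)))
  filter_upwards [Ioo_mem_nhdsGT hε] with t ht
  have h1 := hs.mem_admissibleSet_of_isMIntegralCurveOn hk1 (S := S)
    (γ := fun σ => γ (σ + t)) (sub_pos.2 ht.2)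
    ((hγ.comp_add t).mono fun σ hσ => ⟨by linarith [hσ.1, ht.1], by linarith [hσ.2]⟩)
    (fun σ hσ => hγS _ ⟨by linarith [hσ.1, ht.1], by linarith [hσ.2]⟩)
  simpa using h1

end Invariance

end

theorem theorem4p1 {E : Type*} [NormedAddCommGroup E] [NormedSpace ℝ E] [CompleteSpace E]
    {B : Type*} [TopologicalSpace B] [T2Space B] [ChartedSpace E B]
    (k : ℕ∞) (hk : 4 ≤ k) [IsManifold 𝓘(ℝ, E) k B] :
    haveI : IsManifold 𝓘(ℝ, E) 2 B := isManifold_two hk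
    ∀ (r : ℕ∞), 2 ≤ r → r + 2 ≤ k →
    ∀ (s : (v : TangentBundle 𝓘(ℝ, E) B) → TangentSpace 𝓘(ℝ, E).tangent v), IsSpray r s →
    ∀ (S : Set B), (admissibleSet k s S).Nonempty → IsClosed (admissibleSet k s S) →
      (IsSprayInvariant k s S ↔
        IsAdjacentTangent 𝓘(ℝ, E).tangent (k - 1) s (admissibleSet k s S)) := by
  have : IsManifold 𝓘(ℝ, E) 2 B := isManifold_two hk
  intro r hr _ s hs S _ hA
  have hk2 : 2 ≤ k := le_trans (by norm_num) hk
  have hr1 : 1 ≤ r := le_trans (by norm_num) hr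
  exact ⟨fun h => h.isAdjacentTangent hk2 hs hr1,
    fun h => hs.isSprayInvariant_of_isAdjacentTangent hk2 hr1 hA h⟩
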